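/- Graphs are finite and may have loops and parallel edges. For a graph $H$ let $\Delta H=|E(H)|-|V(H)|$. A \emph{cacti-graph} is a graph with no isolated vertices, no leaves and no component that is a cycle (a loop counts as a cycle with one edge, and contributes two to the degree of its vertex). For a graph $G$ and $X\subseteq E(G)$ let $G\langle X\rangle$ be the subgraph whose edges are the members of $X$ and whose vertices are their ends. For an integer $k\ge 1$, the $k$-circular matroid $M_k(G)$ is the matroid on $E(G)$ whose circuits are the sets $C\subseteq E(G)$ such that $\Delta(G\langle C\rangle)=k$ and $G\langle C\rangle$ is a cacti-graph; $\rho^*_k(G)$ denotes its corank, i.e. the rank of its dual. A matroid is called connected if it has no loops, no coloops, and every two of its elements belong to a common circuit. For a vertex $x$ of $G$ let $S(x,G)$ be the set of edges incident to $x$ and $s(x,G)=|S(x,G)|$. \textbf{Theorem.} Let $G$ be a finite graph without isolated vertices, let $k\ge 1$, and let $x$ be a vertex of $G$. Suppose that $M_k(G)$ is a connected matroid and that $s(x,G)\le \rho^*_k(G)+1$ (i.e. $x$ is not $k$-big). Then $S(x,G)$ is a cocircuit of $M_k(G)$ if and only if $G\setminus x$ (the graph obtained by deleting the vertex $x$ and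 all edges incident to it) has no component that is a tree, where an isolated vertex counts as a tree. -/

import Mathlib

namespace KCircular

/-! ### Finite multigraphs (loops and parallel edges allowed) -/

/-- `G⟨X⟩`: the subgraph of `G` induced by a set `X` of edges. Its edges are the members of `X` and
its vertices are their ends. -/
def edgeInduce {α β : Type*} (G : Graph α β) (X : Set β) : Graph α β :=
  (G.restrict X).induce {v | ∃ e ∈ X, G.Inc e v}

/-- `Δ G = |E(G)| - |V(G)|`, for a finite graph `G`. -/
noncomputable def excess {α β : Type*} (G : Graph α β) : ℤ :=
  (G.edgeSet.ncard : ℤ) - (G.vertexSet.ncard : ℤ)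

/-- The degree of a vertex of a finite graph; a loop counts twice. -/
noncomputable def degree {α β : Type*} (G : Graph α β) (v : α) : ℕ :=
  ({e | G.Inc e v} : Set β).ncard + ({e | G.IsLoopAt e v} : Set β).ncard

/-- The vertex star `S(v, G)`: the set of edges of `G` incident to `v`. -/
def star {α β : Type*} (G : Graph α β) (v : α) : Set β :=
  {e | G.Inc e v}

/-- A graph is connected if it has a vertex and any two vertices are joined by a walk. -/
def Connected {α β : Type*} (G : Graph α β) : Prop :=
  G.vertexSet.Nonempty ∧
    ∀ u ∈ G.vertexSet, ∀ v ∈ G.vertexSet, Relation.ReflTransGen G.Adj u v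

/-- `A` is a (connected) component of `G`: a connected subgraph that contains every edge of `G`
incident to one of its vertices. -/
def IsComponent {α β : Type*} (A G : Graph α β) : Prop :=
  A.IsClosedSubgraph G ∧ Connected A

/-- A finite graph is a cycle if it is connected and every vertex has degree two. A vertex with a
loop is a cycle with one edge; two parallel edges form a cycle with two edges. -/
def IsCycle {α β : Type*} (G : Graph α β) : Prop :=
  Connected G ∧ ∀ v ∈ G.vertexSet, degree G v = 2

/-- A tree is a connected graph without cycles. An isolated vertex is a tree. -/
def IsTree {α β : Type*} (G : Graph α β) : Prop :=
  Connected G ∧ ∀ C ≤ G, ¬ IsCycle C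

/-- A cacti-graph: no isolated vertices, no leaves, and no cycle components. -/
def IsCactiGraph {α β : Type*} (G : Graph α β) : Prop :=
  (∀ v ∈ G.vertexSet, degree G v ≠ 0) ∧
  (∀ v ∈ G.vertexSet, degree G v ≠ 1) ∧
  (∀ A, IsComponent A G → ¬ IsCycle A)

/-- The family `𝒞_k(G)` of the `k`-circuits of `G`. -/
def circuits {α β : Type*} (G : Graph α β) (k : ℕ) : Set (Set β) :=
  {C | C ⊆ G.edgeSet ∧ excess (edgeInduce G C) = k ∧ IsCactiGraph (edgeInduce G C)}

/-! ### The family `𝒞_k(G)` is the family of circuits of a matroid -/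

section Facts

variable {α β : Type*} {G : Graph α β}

/-- The set of ends of the edges in `X`. -/
def ends (G : Graph α β) (X : Set β) : Set α := {v | ∃ e ∈ X, G.Inc e v}

lemma ends_mono {X Y : Set β} (h : X ⊆ Y) : ends G X ⊆ ends G Y :=
  fun _ ⟨e, he, hv⟩ ↦ ⟨e, h he, hv⟩

lemma ends_union (X Y : Set β) : ends G (X ∪ Y) = ends G X ∪ ends G Y := by
  ext v; simp only [ends, Set.mem_union, Set.mem_ofPred_eq]; grind

lemma ends_inter_subset (X Y : Set β) : ends G (X ∩ Y) ⊆ ends G X ∩ ends G Y :=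
  fun _ ⟨e, he, hv⟩ ↦ ⟨⟨e, he.1, hv⟩, ⟨e, he.2, hv⟩⟩

lemma finite_inc (e : β) : {v | G.Inc e v}.Finite := by
  by_cases he : e ∈ G.edgeSet
  · obtain ⟨a, b, hab⟩ := G.exists_isLink_of_mem_edgeSet he
    refine (Set.toFinite {a, b}).subset fun v hv ↦ ?_
    exact hv.eq_or_eq_of_isLink hab
  · convert! Set.finite_empty
    ext v
    simpa using fun h : G.Inc e v ↦ he h.edge_mem

lemma finite_ends {X : Set β} (hX : X.Finite) : (ends G X).Finite := by
  have : ends G X = ⋃ e ∈ X, {v | G.Inc e v} := by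
    ext v; simp [ends]
  rw [this]
  exact hX.biUnion fun e _ ↦ finite_inc e

lemma edgeInduce_vertexSet (X : Set β) : (edgeInduce G X).vertexSet = ends G X := rfl

lemma edgeInduce_isLink {X : Set β} {e : β} {u v : α} :
    (edgeInduce G X).IsLink e u v ↔ e ∈ X ∧ G.IsLink e u v := by
  simp only [edgeInduce, Graph.induce_isLink, Graph.restrict_isLink, Set.mem_ofPred_eq]
  exact ⟨fun h ↦ h.1, fun h ↦ ⟨h, ⟨e, h.1, h.2.inc_left⟩, ⟨e, h.1, h.2.inc_right⟩⟩⟩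

lemma edgeInduce_inc {X : Set β} {e : β} {v : α} :
    (edgeInduce G X).Inc e v ↔ e ∈ X ∧ G.Inc e v := by
  simp [Graph.Inc, edgeInduce_isLink]

lemma edgeInduce_edgeSet {X : Set β} (hX : X ⊆ G.edgeSet) : (edgeInduce G X).edgeSet = X := by
  ext e
  rw [Graph.edge_mem_iff_exists_isLink]
  simp only [edgeInduce_isLink]
  refine ⟨fun ⟨_, _, h⟩ ↦ h.1, fun h ↦ ?_⟩
  obtain ⟨a, b, hab⟩ := G.exists_isLink_of_mem_edgeSet (hX h)
  exact ⟨a, b, h, hab⟩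

/-- The excess of a set of edges. -/
noncomputable def exc (G : Graph α β) (X : Set β) : ℤ := (X.ncard : ℤ) - (ends G X).ncard

lemma excess_edgeInduce {X : Set β} (hX : X ⊆ G.edgeSet) :
    excess (edgeInduce G X) = exc G X := by
  rw [excess, edgeInduce_edgeSet hX, edgeInduce_vertexSet, exc]

lemma exc_empty : exc G ∅ = 0 := by simp [exc, ends]

lemma exc_supermodular {X Y : Set β} (hX : X.Finite) (hY : Y.Finite) :
    exc G X + exc G Y ≤ exc G (X ∪ Y) + exc G (X ∩ Y) := by
  have h1 := Set.ncard_union_add_ncard_inter X Y hX hY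
  have h2 := Set.ncard_union_add_ncard_inter (ends G X) (ends G Y) (finite_ends hX) (finite_ends hY)
  have h3 := Set.ncard_le_ncard (ends_inter_subset (G := G) X Y)
    ((finite_ends hX).subset Set.inter_subset_left)
  simp only [exc, ends_union]
  zify at h1 h2 h3
  linarith

/-- Handshaking: in a finite graph the degrees in a set `U` of vertices count the incidences of
edges with `U`. -/
lemma sum_degree (hE : G.edgeSet.Finite) (a b : β → α)
    (hab : ∀ e ∈ G.edgeSet, G.IsLink e (a e) (b e)) (U : Finset α) :
    (∑ v ∈ U, degree G v) = ∑ e ∈ hE.toFinset,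
      ((open Classical in if a e ∈ U then 1 else 0) +
        (open Classical in if b e ∈ U then 1 else 0)) := by
  classical
  have hd : ∀ v, degree G v = ∑ e ∈ hE.toFinset,
      ((if a e = v then 1 else 0) + (if b e = v then 1 else 0)) := by
    intro v
    have hi : {e | G.Inc e v} = ↑(hE.toFinset.filter fun e ↦ G.Inc e v) := by
      ext e; simp only [Set.mem_ofPred_eq, Finset.coe_filter, Set.Finite.mem_toFinset,
        Set.mem_ofPred_eq]
      exact ⟨fun h ↦ ⟨h.edge_mem, h⟩, fun h ↦ h.2⟩
    have hl : {e | G.IsLoopAt e v} = ↑(hE.toFinset.filter fun e ↦ G.IsLoopAt e v) := by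
      ext e; simp only [Set.mem_ofPred_eq, Finset.coe_filter, Set.Finite.mem_toFinset,
        Set.mem_ofPred_eq]
      exact ⟨fun h ↦ ⟨h.edge_mem, h⟩, fun h ↦ h.2⟩
    rw [degree, hi, hl, Set.ncard_coe_finset, Set.ncard_coe_finset, Finset.card_filter,
      Finset.card_filter, ← Finset.sum_add_distrib]
    refine Finset.sum_congr rfl fun e he ↦ ?_
    have h := hab e (by simpa using he)
    have h1 : G.Inc e v ↔ a e = v ∨ b e = v := by
      constructor
      · intro h'
        rcases h'.eq_or_eq_of_isLink h with h'' | h''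
        · exact Or.inl h''.symm
        · exact Or.inr h''.symm
      · rintro (rfl | rfl)
        · exact h.inc_left
        · exact h.inc_right
    have h2 : G.IsLoopAt e v ↔ a e = v ∧ b e = v := by
      rw [← Graph.isLink_self_iff, h.isLink_iff]; tauto
    rw [if_congr h1 rfl rfl, if_congr h2 rfl rfl]
    by_cases p : a e = v <;> by_cases q : b e = v <;> simp [p, q]
  simp_rw [hd]
  rw [Finset.sum_comm]
  refine Finset.sum_congr rfl fun e _ ↦ ?_
  rw [Finset.sum_add_distrib, Finset.sum_ite_eq, Finset.sum_ite_eq]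

lemma exists_ends (G : Graph α β) [Nonempty α] : ∃ a b : β → α,
    ∀ e ∈ G.edgeSet, G.IsLink e (a e) (b e) := by
  classical
  have : ∀ e, ∃ p : α × α, e ∈ G.edgeSet → G.IsLink e p.1 p.2 := by
    intro e
    by_cases he : e ∈ G.edgeSet
    · obtain ⟨a, b, h⟩ := G.exists_isLink_of_mem_edgeSet he
      exact ⟨(a, b), fun _ ↦ h⟩
    · exact ⟨Classical.arbitrary _, fun h ↦ absurd h he⟩
  choose p hp using this
  exact ⟨fun e ↦ (p e).1, fun e ↦ (p e).2, hp⟩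

lemma IsCycle.card_eq {A : Graph α β} (hA : IsCycle A) (hE : A.edgeSet.Finite)
    (hV : A.vertexSet.Finite) : A.edgeSet.ncard = A.vertexSet.ncard := by
  classical
  obtain ⟨v, -⟩ := hA.1.1
  have : Nonempty α := ⟨v⟩
  obtain ⟨a, b, hab⟩ := exists_ends A
  have h := sum_degree hE a b hab hV.toFinset
  rw [Finset.sum_congr rfl (g := fun _ ↦ 2) (fun v hv ↦ hA.2 v (by simpa using hv)),
    Finset.sum_congr (s₁ := hE.toFinset) rfl (g := fun _ ↦ 2) (fun e he ↦ by
      have h := hab e (by simpa using he)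
      simp [h.left_mem, h.right_mem])] at h
  rw [Set.ncard_eq_toFinset_card _ hE, Set.ncard_eq_toFinset_card _ hV]
  simp only [Finset.sum_const, smul_eq_mul] at h
  omega

lemma exists_circuit_subset {k : ℕ} (hk : 1 ≤ k) {X : Set β} (hX : X ⊆ G.edgeSet)
    (hfin : X.Finite) (h : (k : ℤ) ≤ exc G X) : ∃ C ⊆ X, C ∈ circuits G k := by
  classical
  obtain ⟨Y, hYX, hYmin⟩ := (hfin.finite_subsets.subset
    (s := {Y | Y ⊆ X} ) (t := {Y | Y ⊆ X ∧ (k : ℤ) ≤ exc G Y}) (fun _ h ↦ h.1)).exists_le_minimal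
      (a := X) ⟨subset_rfl, h⟩
  have hY := hYmin.prop.2
  have hYfin : Y.Finite := hfin.subset hYX
  have hYE : Y ⊆ G.edgeSet := hYX.trans hX
  have hmin : ∀ Z ⊆ Y, Z ≠ Y → exc G Z < k := by
    intro Z hZ hne
    by_contra! hc
    exact hne (hZ.antisymm (hYmin.le_of_le ⟨hZ.trans hYX, hc⟩ hZ))
  have hsub : ∀ e, ends G (Y \ {e}) ⊆ ends G Y := fun e ↦ ends_mono Set.sdiff_subset
  refine ⟨Y, hYX, hYE, ?_, ?_, ?_, ?_⟩
  · rw [excess_edgeInduce hYE]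
    refine le_antisymm ?_ hY
    obtain ⟨e, he⟩ : Y.Nonempty := by
      rw [Set.nonempty_iff_ne_empty]
      rintro rfl
      rw [exc_empty] at hY
      omega
    have h1 := hmin (Y \ {e}) Set.sdiff_subset (fun h ↦ by rw [← h] at he; exact he.2 rfl)
    have h2 := Set.ncard_sdiff_singleton_add_one he hYfin
    have h3 := Set.ncard_le_ncard (hsub e) (finite_ends hYfin)
    simp only [exc] at h1 ⊢
    omega
  · rintro v ⟨e, he, hv⟩ h0
    have : {e | (edgeInduce G Y).Inc e v} = ∅ := by
      have hf : ({e | (edgeInduce G Y).Inc e v}).Finite :=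
        hYfin.subset fun e he ↦ (edgeInduce_inc.1 he).1
      rw [← Set.ncard_eq_zero hf]
      simp only [degree] at h0
      omega
    exact absurd (show e ∈ {e | (edgeInduce G Y).Inc e v} from edgeInduce_inc.2 ⟨he, hv⟩)
      (by simp [this])
  · rintro v ⟨e, he, hv⟩ h1
    have hf : ({e | (edgeInduce G Y).Inc e v}).Finite :=
      hYfin.subset fun e he ↦ (edgeInduce_inc.1 he).1
    have hle : ({e | (edgeInduce G Y).Inc e v}).ncard ≤ 1 := by
      simp only [degree] at h1
      omega
    have huniq : ∀ f ∈ Y, G.Inc f v → f = e := fun f hf' hfv ↦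
      (Set.ncard_le_one hf).1 hle f (edgeInduce_inc.2 ⟨hf', hfv⟩) e (edgeInduce_inc.2 ⟨he, hv⟩)
    have h1 := hmin (Y \ {e}) Set.sdiff_subset (fun h ↦ by rw [← h] at he; exact he.2 rfl)
    have h2 := Set.ncard_sdiff_singleton_add_one he hYfin
    have h3 : (ends G (Y \ {e})).ncard < (ends G Y).ncard := by
      refine Set.ncard_lt_ncard ⟨hsub e, fun hc ↦ ?_⟩ (finite_ends hYfin)
      obtain ⟨f, hf', hfv⟩ := hc ⟨e, he, hv⟩
      exact hf'.2 (huniq f hf'.1 hfv)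
    simp only [exc] at h1 hY
    omega
  · intro A hA hcyc
    have hAE : A.edgeSet ⊆ Y := by
      have := hA.1.le.edgeSet_mono
      rwa [edgeInduce_edgeSet hYE] at this
    have hAV : A.vertexSet ⊆ ends G Y := hA.1.le.vertexSet_mono
    have hcard := hcyc.card_eq (hYfin.subset hAE) ((finite_ends hYfin).subset hAV)
    obtain ⟨v, hv⟩ := hcyc.1.1
    have hclosed : ∀ e ∈ Y, ∀ u ∈ A.vertexSet, G.Inc e u → e ∈ A.edgeSet := fun e he u hu h ↦
      hA.1.closed (edgeInduce_inc.2 ⟨he, h⟩) hu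
    have hne : Y \ A.edgeSet ≠ Y := by
      intro hc
      obtain ⟨e, he, hev⟩ := hAV hv
      have h' := hclosed e he v hv hev
      rw [← hc] at he
      exact he.2 h'
    have h1 := hmin _ Set.sdiff_subset hne
    have h2 := Set.ncard_sdiff_add_ncard_of_subset hAE hYfin
    have h3 : (ends G (Y \ A.edgeSet)).ncard ≤ (ends G Y \ A.vertexSet).ncard := by
      refine Set.ncard_le_ncard ?_ ((finite_ends hYfin).subset Set.sdiff_subset)
      rintro u ⟨e, he, heu⟩
      exact ⟨⟨e, he.1, heu⟩, fun hu ↦ he.2 (hclosed e he.1 u hu heu)⟩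
    have h4 := Set.ncard_sdiff_add_ncard_of_subset hAV (finite_ends hYfin)
    simp only [exc] at h1 hY
    omega

/-- A set of edges of `G` contains no `k`-circuit if and only if each of its subsets has excess
less than `k`. -/
lemma noCircuit_iff {k : ℕ} (hk : 1 ≤ k) {I : Set β} (hI : I ⊆ G.edgeSet) (hfin : I.Finite) :
    (∀ C ∈ circuits G k, ¬ C ⊆ I) ↔ ∀ Y ⊆ I, exc G Y < k := by
  constructor
  · intro h Y hY
    by_contra! hc
    obtain ⟨C, hCY, hC⟩ := exists_circuit_subset hk (hY.trans hI) (hfin.subset hY) hc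
    exact h C hC (hCY.trans hY)
  · intro h C hC hCI
    have := h C hCI
    rw [← excess_edgeInduce hC.1, hC.2.1] at this
    exact lt_irrefl _ this

lemma augment {k : ℕ} {I J : Set β} (hIf : I.Finite)
    (hJf : J.Finite) (hI : ∀ Y ⊆ I, exc G Y < k) (hJ : ∀ Y ⊆ J, exc G Y < k)
    (hcard : I.ncard < J.ncard) : ∃ e ∈ J, e ∉ I ∧ ∀ Y ⊆ insert e I, exc G Y < k := by
  classical
  by_contra! hcon
  -- every element of `J \ I` is spanned by a tight subset of `I`
  have htight : ∀ e ∈ J \ I, ∃ Y ⊆ I, exc G Y = k - 1 ∧ ends G {e} ⊆ ends G Y := by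
    intro e he
    obtain ⟨Y, hY, hYk⟩ := hcon e he.1 he.2
    have heY : e ∈ Y := by
      by_contra h
      have := hI Y ((Set.subset_insert_iff_of_notMem h).1 hY)
      omega
    have hYf : Y.Finite := (hIf.insert e).subset hY
    have hsub : Y \ {e} ⊆ I := by
      intro f hf
      exact (hY hf.1).resolve_left hf.2
    have h1 := hI _ hsub
    have h2 := Set.ncard_sdiff_singleton_add_one heY hYf
    have hm : ends G (Y \ {e}) ⊆ ends G Y := ends_mono Set.sdiff_subset
    have h3 := Set.ncard_le_ncard hm (finite_ends hYf)
    simp only [exc] at h1 hYk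
    refine ⟨Y \ {e}, hsub, by simp only [exc]; omega, ?_⟩
    have h4 : ends G (Y \ {e}) = ends G Y :=
      Set.eq_of_subset_of_ncard_le hm (by omega) (finite_ends hYf)
    rw [h4]
    exact ends_mono (by simpa using heY)
  -- tight sets are closed under union
  have hunion : ∀ D : Set β, D.Finite → D ⊆ J \ I → D.Nonempty →
      ∃ T ⊆ I, exc G T = k - 1 ∧ ends G D ⊆ ends G T := by
    intro D hD
    induction D, hD using Set.Finite.induction_on with
    | empty => intro _ h; exact absurd h Set.not_nonempty_empty
    | @insert e D _ _ ih =>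
      intro hDJ _
      obtain ⟨Y, hYI, hYk, hYe⟩ := htight e (hDJ (Set.mem_insert _ _))
      rcases D.eq_empty_or_nonempty with rfl | hne
      · exact ⟨Y, hYI, hYk, by simpa using hYe⟩
      · obtain ⟨T, hTI, hTk, hTD⟩ := ih ((Set.subset_insert _ _).trans hDJ) hne
        refine ⟨Y ∪ T, Set.union_subset hYI hTI, ?_, ?_⟩
        · have h1 := exc_supermodular (G := G) (hIf.subset hYI) (hIf.subset hTI)
          have h2 := hI _ (Set.union_subset hYI hTI)
          have h3 := hI (Y ∩ T) (Set.inter_subset_left.trans hYI)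
          omega
        · rw [Set.insert_eq, ends_union, ends_union]
          exact Set.union_subset_union hYe hTD
  have hne : (J \ I).Nonempty := by
    rw [Set.nonempty_iff_ne_empty]
    intro h
    rw [Set.sdiff_eq_empty] at h
    exact absurd (Set.ncard_le_ncard h hIf) (by omega)
  obtain ⟨T, hTI, hTk, hTD⟩ := hunion (J \ I) (hJf.subset Set.sdiff_subset) subset_rfl hne
  have hTf := hIf.subset hTI
  have h1 := hJ ((J ∩ T) ∪ (J \ I)) (Set.union_subset Set.inter_subset_left Set.sdiff_subset)
  have h2 : (ends G ((J ∩ T) ∪ (J \ I))).ncard ≤ (ends G T).ncard := by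
    refine Set.ncard_le_ncard ?_ (finite_ends hTf)
    rw [ends_union]
    exact Set.union_subset (ends_mono Set.inter_subset_right) hTD
  have h3 : ((J ∩ T) ∪ (J \ I)).ncard = (J ∩ T).ncard + (J \ I).ncard :=
    Set.ncard_union_eq (Set.disjoint_left.2 fun e he he' ↦ he'.2 (hTI he.2))
      (hJf.subset Set.inter_subset_left) (hJf.subset Set.sdiff_subset)
  have h4 : J.ncard ≤ ((J ∩ T) ∪ (J \ I)).ncard + (I \ T).ncard := by
    refine (Set.ncard_le_ncard ?_ ?_).trans (Set.ncard_union_le _ _)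
    · intro e he
      by_cases h1 : e ∈ I <;> by_cases h2 : e ∈ T <;> simp [h1, h2, he]
    · exact ((hJf.subset Set.inter_subset_left).union (hJf.subset Set.sdiff_subset)).union
        (hIf.subset Set.sdiff_subset)
  have h5 := Set.ncard_sdiff_add_ncard_of_subset hTI hIf
  simp only [exc] at h1 hTk
  omega

/-- Removing edges from a cacti-graph lowers the excess. -/
lemma exc_lt_of_ssubset {Y Z : Set β} (hYE : Y ⊆ G.edgeSet) (hYfin : Y.Finite)
    (hY : IsCactiGraph (edgeInduce G Y)) (hZ : Z ⊆ Y) (hne : Z ≠ Y) : exc G Z < exc G Y := by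
  classical
  by_contra! hcon
  set H := edgeInduce G Y with hH
  have hHE : H.edgeSet = Y := edgeInduce_edgeSet hYE
  obtain ⟨e₀, he₀Y, he₀Z⟩ : ∃ e ∈ Y, e ∉ Z := by
    by_contra! h
    exact hne (hZ.antisymm h)
  obtain ⟨a₀, b₀, -⟩ := G.exists_isLink_of_mem_edgeSet (hYE he₀Y)
  have : Nonempty α := ⟨a₀⟩
  obtain ⟨a, b, hab⟩ := exists_ends H
  have hEf : H.edgeSet.Finite := by rw [hHE]; exact hYfin
  have hUf : (ends G Y \ ends G Z).Finite := (finite_ends hYfin).subset Set.sdiff_subset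
  have hsum := sum_degree hEf a b hab hUf.toFinset
  set U := hUf.toFinset with hU
  have hmemU : ∀ v, v ∈ U ↔ v ∈ ends G Y ∧ v ∉ ends G Z := fun v ↦ by simp [hU]
  -- the degrees in `U` are at least two
  have hdeg : ∀ v ∈ U, 2 ≤ degree H v := by
    intro v hv
    have hv' : v ∈ H.vertexSet := ((hmemU v).1 hv).1
    have h0 := hY.1 v hv'
    have h1 := hY.2.1 v hv'
    omega
  -- the edges incident to `U` lie outside `Z`
  have hinc : ∀ e v, H.Inc e v → v ∈ U → e ∉ Z := fun e v he hv heZ ↦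
    ((hmemU v).1 hv).2 ⟨e, heZ, (edgeInduce_inc.1 he).2⟩
  have hbound : ∀ e ∈ hEf.toFinset, ((if a e ∈ U then 1 else 0) + (if b e ∈ U then 1 else 0)) ≤
      (if e ∉ Z then 2 else 0) := by
    intro e he
    have h := hab e (by simpa using he)
    by_cases h1 : a e ∈ U
    · have := hinc e _ h.inc_left h1
      rw [if_pos this]
      split_ifs <;> omega
    · by_cases h2 : b e ∈ U
      · have := hinc e _ h.inc_right h2
        rw [if_pos this]
        split_ifs; omega
      · simp [h1, h2]
  have hD : (∑ e ∈ hEf.toFinset, if e ∉ Z then 2 else 0) = 2 * (Y \ Z).ncard := by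
    have : (Y \ Z) = ↑(hEf.toFinset.filter fun e ↦ e ∉ Z) := by
      ext e; simp [hHE]
    rw [this, Set.ncard_coe_finset, ← Finset.sum_filter, Finset.sum_const, smul_eq_mul, mul_comm]
  have hcU : (ends G Y \ ends G Z).ncard = U.card := Set.ncard_eq_toFinset_card _ hUf
  have h1 := Set.ncard_sdiff_add_ncard_of_subset hZ hYfin
  have h2 := Set.ncard_sdiff_add_ncard_of_subset (ends_mono (G := G) hZ) (finite_ends hYfin)
  have hDU : (Y \ Z).ncard ≤ U.card := by
    simp only [exc] at hcon
    omega
  have hlow : (∑ _v ∈ U, 2) ≤ ∑ v ∈ U, degree H v := Finset.sum_le_sum hdeg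
  have hlow' : (∑ _v ∈ U, 2) = 2 * U.card := by rw [Finset.sum_const, smul_eq_mul, mul_comm]
  have hup := Finset.sum_le_sum hbound
  -- hence all the inequalities are equalities
  have hdeg2 : ∀ v ∈ U, degree H v = 2 := fun v hv ↦
    ((Finset.sum_eq_sum_iff_of_le hdeg).1 (by omega) v hv).symm
  have hboth : ∀ e ∈ Y, e ∉ Z → a e ∈ U ∧ b e ∈ U := by
    intro e he heZ
    have h := (Finset.sum_eq_sum_iff_of_le hbound).1 (by omega) e (by simpa [hHE] using he)
    rw [if_pos heZ] at h
    by_cases h1 : a e ∈ U <;> by_cases h2 : b e ∈ U <;> simp only [h1, h2, if_true, if_false] at h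
    · exact ⟨h1, h2⟩
    all_goals omega
  have hstep : ∀ v w, v ∈ U → H.Adj v w → w ∈ U := by
    rintro v w hv ⟨e, he⟩
    have heY : e ∈ Y := hHE ▸ he.edge_mem
    obtain ⟨h1, h2⟩ := hboth e heY (hinc e v he.inc_left hv)
    rcases he.inc_right.eq_or_eq_of_isLink (hab e he.edge_mem) with rfl | rfl
    · exact h1
    · exact h2
  -- the component of a vertex of `U` is a cycle
  have hu : a e₀ ∈ U := (hboth e₀ he₀Y he₀Z).1
  set u := a e₀ with hu_def
  set W : Set α := {w | Relation.ReflTransGen H.Adj u w} with hW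
  have hWU : ∀ w ∈ W, w ∈ U := by
    intro w hw
    induction hw with
    | refl => exact hu
    | tail _ h ih => exact hstep _ _ ih h
  have hWV : W ⊆ H.vertexSet := fun w hw ↦ ((hmemU w).1 (hWU w hw)).1
  have hWcl : ∀ e v w, H.IsLink e v w → v ∈ W → w ∈ W := fun e v w h hv ↦
    Relation.ReflTransGen.tail hv ⟨e, h⟩
  have hclosed : (H.induce W).IsClosedSubgraph H := by
    refine Graph.IsClosedSubgraph.mk' (Graph.induce_le hWV) ?_
    rintro e v ⟨w, h⟩ hv
    exact ⟨v, w, h, hv, hWcl e v w h hv⟩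
  have hconn : Connected (H.induce W) := by
    have hreach : ∀ w ∈ W, Relation.ReflTransGen (H.induce W).Adj u w := by
      intro w hw
      induction hw with
      | refl => exact Relation.ReflTransGen.refl
      | @tail v w hv h ih =>
        obtain ⟨e, he⟩ := h
        exact ih.tail ⟨e, he, hv, hWcl e v w he hv⟩
    refine ⟨⟨u, Relation.ReflTransGen.refl⟩, fun v hv w hw ↦ ?_⟩
    exact (Std.Symm.symm _ _ (hreach v hv)).trans (hreach w hw)
  refine hY.2.2 _ ⟨hclosed, hconn⟩ ⟨hconn, fun v hv ↦ ?_⟩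
  rw [← hdeg2 v (hWU v hv)]
  have hv' : v ∈ W := hv
  have h1 : {e | (H.induce W).Inc e v} = {e | H.Inc e v} := by
    ext e
    constructor
    · rintro ⟨w, h⟩
      exact ⟨w, h.1⟩
    · rintro ⟨w, h⟩
      exact ⟨w, h, hv', hWcl e v w h hv'⟩
  have h2 : {e | (H.induce W).IsLoopAt e v} = {e | H.IsLoopAt e v} := by
    ext e
    constructor
    · intro h
      exact h.1
    · intro h
      exact ⟨h, hv', hv'⟩
  rw [degree, degree, h1, h2]

end Facts

/-- The `k`-circular matroid `M_k(G)` of a finite graph `G`, for `k ≥ 1`: the matroid on `E(G)`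
whose independent sets are the sets of edges that contain no member of `𝒞_k(G)`. -/
def kCircularMatroid {α β : Type*} (G : Graph α β) (hE : G.edgeSet.Finite) (k : ℕ) (hk : 1 ≤ k) :
    Matroid β :=
  (IndepMatroid.ofFinite hE (fun I ↦ I ⊆ G.edgeSet ∧ ∀ C ∈ circuits G k, ¬ C ⊆ I)
    (by
      refine ⟨Set.empty_subset _, ?_⟩
      rw [noCircuit_iff hk (Set.empty_subset _) Set.finite_empty]
      intro Y hY
      rw [Set.subset_empty_iff.1 hY, exc_empty]
      omega)
    (fun _ _ hJ hIJ ↦ ⟨hIJ.trans hJ.1, fun C hC hCI ↦ hJ.2 C hC (hCI.trans hIJ)⟩)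
    (by
      rintro I J ⟨hIE, hI⟩ ⟨hJE, hJ⟩ hcard
      have hIf := hE.subset hIE
      have hJf := hE.subset hJE
      rw [noCircuit_iff hk hIE hIf] at hI
      rw [noCircuit_iff hk hJE hJf] at hJ
      obtain ⟨e, heJ, heI, h⟩ := augment hIf hJf hI hJ hcard
      have hsub : insert e I ⊆ G.edgeSet := Set.insert_subset (hJE heJ) hIE
      exact ⟨e, heJ, heI, hsub, (noCircuit_iff hk hsub (hIf.insert e)).2 h⟩)
    (fun _ h ↦ h.1)).matroid

lemma kCircularMatroid_indep_iff {α β : Type*} {G : Graph α β} {hE : G.edgeSet.Finite} {k : ℕ}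
    {hk : 1 ≤ k} {I : Set β} : (kCircularMatroid G hE k hk).Indep I ↔
      I ⊆ G.edgeSet ∧ ∀ C ∈ circuits G k, ¬ C ⊆ I := by
  simp [kCircularMatroid]

lemma kCircularMatroid_ground {α β : Type*} {G : Graph α β} {hE : G.edgeSet.Finite} {k : ℕ}
    {hk : 1 ≤ k} : (kCircularMatroid G hE k hk).E = G.edgeSet := rfl

/-- The circuits of `M_k(G)` are exactly the members of `𝒞_k(G)`. -/
theorem kCircularMatroid_isCircuit_iff {α β : Type*} {G : Graph α β} {hE : G.edgeSet.Finite}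
    {k : ℕ} {hk : 1 ≤ k} {C : Set β} :
    (kCircularMatroid G hE k hk).IsCircuit C ↔ C ∈ circuits G k := by
  have key : ∀ D ∈ circuits G k, (kCircularMatroid G hE k hk).IsCircuit D := by
    intro D hD
    rw [Matroid.isCircuit_iff_forall_ssubset, Matroid.Dep, kCircularMatroid_indep_iff,
      kCircularMatroid_ground]
    refine ⟨⟨fun h ↦ h.2 D hD subset_rfl, hD.1⟩, fun I hI ↦ ?_⟩
    have hID : I ⊆ D := hI.subset
    rw [kCircularMatroid_indep_iff]
    refine ⟨hID.trans hD.1, fun C hC hCI ↦ ?_⟩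
    have h := exc_lt_of_ssubset hD.1 (hE.subset hD.1) hD.2.2 (hCI.trans hID)
      (fun h ↦ hI.ne (hID.antisymm (h ▸ hCI)))
    rw [← excess_edgeInduce hD.1, ← excess_edgeInduce hC.1, hD.2.1, hC.2.1] at h
    exact lt_irrefl _ h
  refine ⟨fun h ↦ ?_, key C⟩
  have hdep := h.not_indep
  rw [kCircularMatroid_indep_iff] at hdep
  push Not at hdep
  obtain ⟨D, hD, hDC⟩ := hdep h.subset_ground
  rwa [← (key D hD).eq_of_subset_isCircuit h hDC]

/-- A matroid is connected if it has no loops, no coloops, and every two elements of its ground set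
lie in a common circuit. -/
def MatroidConnected {β : Type*} (M : Matroid β) : Prop :=
  (∀ e ∈ M.E, ¬ M.IsLoop e) ∧ (∀ e ∈ M.E, ¬ M.IsColoop e) ∧
  ∀ e ∈ M.E, ∀ f ∈ M.E, ∃ C, M.IsCircuit C ∧ e ∈ C ∧ f ∈ C

end KCircular

/-! Write exc(Y) for the number of edges of Y minus the number of their ends. A set of edges is
independent in M_k(G) exactly when all its subsets have exc < k. Hence a dependent set X has rank k
- 1 + |X| - m(X), where m(X) is the maximum of exc over subsets of X. The inequality is
`exc_le_of_forall_exc_lt`. It is attained (`exists_exc_eq_of_maximal`) because the edges outside a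
basis are spanned by tight sets (exc = k - 1), and supermodularity makes tight sets closed under
union.

If M_k(G) is connected, circuits cover E(G), so m(E) = exc(E) and the rank of M_k(G) is |V| + k - 1
(`ncard_of_isBase`). Let F be the set of edges avoiding x. The star of x is a cocircuit iff F is a
hyperplane, that is, has rank |V| + k - 2. Since x is not k-big, |F| is at least this number. As
exc(F) is at least Δ(G\x) = |F| - |V| + 1, the rank of F is at most |V| + k - 2, with equality iff
no subset of F has exc above Δ(G\x).

That condition says that G\x has no tree component (`forall_not_isTree_iff`). Deleting the edges of
a tree component loses more ends than edges, so it raises exc. Conversely, a minimal vertex set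
meeting fewer edges than it has vertices induces a tree component. -/

namespace KCircular

section

variable {α β : Type*} {G : Graph α β}

/-! ### Excess and rank -/

/-- An independent set bounds the excess of every subset of a set containing it. -/
lemma exc_le_of_forall_exc_lt {k : ℕ} {I X Y : Set β} (hX : X.Finite) (hIX : I ⊆ X)
    (hI : ∀ Z ⊆ I, exc G Z < k) (hY : Y ⊆ X) : exc G Y ≤ k - 1 + X.ncard - I.ncard := by
  have h1 := hI (Y ∩ I) Set.inter_subset_right
  have h2 := Set.ncard_le_ncard (ends_mono (G := G) (Set.inter_subset_left (s := Y) (t := I)))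
    (finite_ends (hX.subset hY))
  have h3 := Set.ncard_inter_add_ncard_sdiff_eq_ncard Y I (hX.subset hY)
  have h4 := Set.ncard_le_ncard (Set.sdiff_subset_sdiff_left (t := I) hY)
    (hX.subset Set.sdiff_subset)
  have h5 := Set.ncard_sdiff_add_ncard_of_subset hIX hX
  simp only [exc] at h1 ⊢
  omega

/-- A maximal independent subset of `X` either is `X` or attains the bound of
`exc_le_of_forall_exc_lt`. -/
lemma exists_exc_eq_of_maximal {k : ℕ} {I X : Set β} (hX : X.Finite) (hIX : I ⊆ X) (hne : I ≠ X)
    (hI : ∀ Z ⊆ I, exc G Z < k)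
    (hmax : ∀ e ∈ X, e ∉ I → ∃ Y ⊆ insert e I, (k : ℤ) ≤ exc G Y) :
    ∃ Y ⊆ X, exc G Y = k - 1 + X.ncard - I.ncard := by
  classical
  have hIf := hX.subset hIX
  -- A violating Y must contain e. Removing e brings the excess below k while losing one edge, so
  -- the excess drops by exactly one and no end is lost.
  have htight : ∀ e ∈ X \ I, ∃ Y ⊆ I, exc G Y = k - 1 ∧ ends G {e} ⊆ ends G Y := by
    intro e he
    obtain ⟨Y, hY, hYk⟩ := hmax e he.1 he.2
    have heY : e ∈ Y := by
      by_contra h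
      have := hI Y ((Set.subset_insert_iff_of_notMem h).1 hY)
      omega
    have hYf : Y.Finite := (hIf.insert e).subset hY
    have hsub : Y \ {e} ⊆ I := fun f hf ↦ (hY hf.1).resolve_left hf.2
    have h1 := hI _ hsub
    have h2 := Set.ncard_sdiff_singleton_add_one heY hYf
    have hm : ends G (Y \ {e}) ⊆ ends G Y := ends_mono Set.sdiff_subset
    have h3 := Set.ncard_le_ncard hm (finite_ends hYf)
    simp only [exc] at h1 hYk
    refine ⟨Y \ {e}, hsub, by simp only [exc]; omega, ?_⟩
    rw [Set.eq_of_subset_of_ncard_le hm (by omega) (finite_ends hYf)]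
    exact ends_mono (by simpa using heY)
  -- For tight Y and T, supermodularity gives 2(k - 1) ≤ exc(Y ∪ T) + exc(Y ∩ T), and both terms are
  -- at most k - 1 inside I.
  have hunion : ∀ D : Set β, D.Finite → D ⊆ X \ I → D.Nonempty →
      ∃ T ⊆ I, exc G T = k - 1 ∧ ends G D ⊆ ends G T := by
    intro D hD
    induction D, hD using Set.Finite.induction_on with
    | empty => intro _ h; exact absurd h Set.not_nonempty_empty
    | @insert e D _ _ ih =>
      intro hDJ _
      obtain ⟨Y, hYI, hYk, hYe⟩ := htight e (hDJ (Set.mem_insert _ _))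
      rcases D.eq_empty_or_nonempty with rfl | hne
      · exact ⟨Y, hYI, hYk, by simpa using hYe⟩
      · obtain ⟨T, hTI, hTk, hTD⟩ := ih ((Set.subset_insert _ _).trans hDJ) hne
        refine ⟨Y ∪ T, Set.union_subset hYI hTI, ?_, ?_⟩
        · have h1 := exc_supermodular (G := G) (hIf.subset hYI) (hIf.subset hTI)
          have h2 := hI _ (Set.union_subset hYI hTI)
          have h3 := hI (Y ∩ T) (Set.inter_subset_left.trans hYI)
          omega
        · rw [Set.insert_eq, ends_union, ends_union]
          exact Set.union_subset_union hYe hTD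
  have hDne : (X \ I).Nonempty := by
    rw [Set.nonempty_iff_ne_empty, Ne, Set.sdiff_eq_empty]
    exact fun h ↦ hne (hIX.antisymm h)
  obtain ⟨T, hTI, hTk, hTD⟩ := hunion (X \ I) (hX.subset Set.sdiff_subset) subset_rfl hDne
  -- All ends of X \ I already lie in T, so each of these edges adds one to the excess.
  refine ⟨T ∪ (X \ I), Set.union_subset (hTI.trans hIX) Set.sdiff_subset, ?_⟩
  have h1 : (T ∪ (X \ I)).ncard = T.ncard + (X \ I).ncard :=
    Set.ncard_union_eq (Set.disjoint_left.2 fun e he he' ↦ he'.2 (hTI he)) (hIf.subset hTI)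
      (hX.subset Set.sdiff_subset)
  have h2 : ends G (T ∪ (X \ I)) = ends G T := by rw [ends_union, Set.union_eq_left.2 hTD]
  have h3 := Set.ncard_sdiff_add_ncard_of_subset hIX hX
  simp only [exc, h1, h2] at hTk ⊢
  omega

/-- If the circuits cover the edges, then no set of edges has larger excess than `E(G)`. -/
lemma exc_le_exc_edgeSet {k : ℕ} (hE : G.edgeSet.Finite)
    (hcov : ∀ e ∈ G.edgeSet, ∃ C ∈ circuits G k, e ∈ C) {Y : Set β} (hY : Y ⊆ G.edgeSet) :
    exc G Y ≤ exc G G.edgeSet := by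
  obtain ⟨Z, -, hZ⟩ := (hE.finite_subsets.subset (s := {Z | Z ⊆ G.edgeSet})
    (t := {Z | Z ⊆ G.edgeSet ∧ exc G Y ≤ exc G Z}) (fun _ h ↦ h.1)).exists_le_maximal
      (a := Y) ⟨hY, le_rfl⟩
  have hZE := hZ.prop.1
  suffices h : Z = G.edgeSet from h ▸ hZ.prop.2
  refine hZE.antisymm fun e he ↦ ?_
  obtain ⟨C, hC, heC⟩ := hcov e he
  have h1 := exc_supermodular (G := G) (hE.subset hZE) (hE.subset hC.1)
  -- A cacti-graph has larger excess than its proper edge subsets, so adjoining a circuit to Z never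
  -- lowers the excess. A maximal Z therefore contains every circuit.
  have h2 : exc G (Z ∩ C) ≤ exc G C := by
    by_cases h : Z ∩ C = C
    · rw [h]
    · exact (exc_lt_of_ssubset hC.1 (hE.subset hC.1) hC.2.2 Set.inter_subset_right h).le
  exact hZ.le_of_ge (y := Z ∪ C)
    ⟨Set.union_subset hZE hC.1, hZ.prop.2.trans (by omega)⟩ Set.subset_union_left (Or.inr heC)

lemma ends_edgeSet (hiso : ∀ v ∈ G.vertexSet, ∃ e, G.Inc e v) :
    ends G G.edgeSet = G.vertexSet := by
  ext v
  constructor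
  · rintro ⟨e, -, h⟩
    exact h.vertex_mem
  · intro hv
    obtain ⟨e, he⟩ := hiso v hv
    exact ⟨e, he.edge_mem, he⟩

/-! ### Cycles, tree components and excess -/

lemma edgeInduce_le {X : Set β} : edgeInduce G X ≤ G where
  vertexSet_mono := by
    rintro v ⟨e, -, h⟩
    exact h.vertex_mem
  isLink_mono := fun _ _ _ h ↦ (edgeInduce_isLink.1 h).2

/-- A finite graph without cycles has no nonempty set of edges of nonnegative excess. -/
lemma exists_isCycle_le (hE : G.edgeSet.Finite) {X : Set β} (hX : X ⊆ G.edgeSet)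
    (hne : X.Nonempty) (h0 : 0 ≤ exc G X) : ∃ C ≤ G, IsCycle C := by
  classical
  -- A minimal Y has excess exactly 0. It is not a cacti-graph, because the empty set also has
  -- excess 0. It has no isolated vertices, and a leaf would contradict minimality, so some
  -- component is a cycle.
  obtain ⟨Y, hYX, hYmin⟩ := (hE.finite_subsets.subset (s := {Y | Y ⊆ G.edgeSet})
    (t := {Y | Y ⊆ G.edgeSet ∧ Y.Nonempty ∧ 0 ≤ exc G Y}) (fun _ h ↦ h.1)).exists_le_minimal
      (a := X) ⟨hX, hne, h0⟩
  obtain ⟨hYE, hYne, hY0⟩ := hYmin.prop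
  have hYf := hE.subset hYE
  have hmin : ∀ e ∈ Y, (ends G (Y \ {e})).Nonempty → exc G (Y \ {e}) < 0 := by
    rintro e he ⟨v, f, hf, -⟩
    by_contra! hc
    exact (hYmin.le_of_le ⟨Set.sdiff_subset.trans hYE, ⟨f, hf⟩, hc⟩ Set.sdiff_subset he).2 rfl
  have hcard : ∀ e ∈ Y, (Y \ {e}).ncard + 1 = Y.ncard := fun e he ↦
    Set.ncard_sdiff_singleton_add_one he hYf
  have hends : ∀ e, (ends G (Y \ {e})).ncard ≤ (ends G Y).ncard := fun e ↦
    Set.ncard_le_ncard (ends_mono Set.sdiff_subset) (finite_ends hYf)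
  have hempty : ∀ e ∈ Y, ends G (Y \ {e}) = ∅ → Y = {e} := by
    intro e he h
    refine Set.Subset.antisymm (fun f hf ↦ ?_) (by simpa using he)
    by_contra hfe
    obtain ⟨a, b, hab⟩ := G.exists_isLink_of_mem_edgeSet (hYE hf)
    exact (h ▸ (⟨f, ⟨hf, hfe⟩, hab.inc_left⟩ : a ∈ ends G (Y \ {e})) : a ∈ (∅ : Set α))
  have hle : exc G Y ≤ 0 := by
    obtain ⟨e, he⟩ := hYne
    rcases (ends G (Y \ {e})).eq_empty_or_nonempty with h | h
    · have hYe := hempty e he h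
      obtain ⟨a, b, hab⟩ := G.exists_isLink_of_mem_edgeSet (hYE he)
      have := (Set.ncard_pos (finite_ends hYf)).2 ⟨a, e, he, hab.inc_left⟩
      have h1 : Y.ncard = 1 := by rw [hYe, Set.ncard_singleton]
      simp only [exc]
      omega
    · have h1 := hmin e he h
      have h2 := hcard e he
      have h3 := hends e
      simp only [exc] at h1 ⊢
      omega
  have hfin : ∀ v, {e | (edgeInduce G Y).Inc e v}.Finite := fun v ↦
    hYf.subset fun e he ↦ (edgeInduce_inc.1 he).1
  have hnot : ¬ IsCactiGraph (edgeInduce G Y) := by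
    intro h
    have := exc_lt_of_ssubset hYE hYf h (Set.empty_subset _) hYne.ne_empty.symm
    rw [exc_empty] at this
    omega
  have hA : ∃ A, IsComponent A (edgeInduce G Y) ∧ IsCycle A := by
    by_contra! hcon
    refine hnot ⟨?_, ?_, hcon⟩
    · rintro v ⟨e, he, hv⟩ hd
      have : {e | (edgeInduce G Y).Inc e v} = ∅ := by
        rw [← Set.ncard_eq_zero (hfin v)]
        simp only [degree] at hd
        omega
      exact absurd (show e ∈ {e | (edgeInduce G Y).Inc e v} from edgeInduce_inc.2 ⟨he, hv⟩)
        (by simp [this])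
    · rintro v ⟨e, he, hv⟩ hd
      have hpos : 0 < ({e | (edgeInduce G Y).Inc e v}).ncard :=
        (Set.ncard_pos (hfin v)).2 ⟨e, edgeInduce_inc.2 ⟨he, hv⟩⟩
      have hone : ({e | (edgeInduce G Y).Inc e v}).ncard ≤ 1 := by
        simp only [degree] at hd
        omega
      have hloop : ({e | (edgeInduce G Y).IsLoopAt e v}).ncard = 0 := by
        simp only [degree] at hd
        omega
      have huniq : ∀ f ∈ Y, G.Inc f v → f = e := fun f hf hfv ↦
        (Set.ncard_le_one (hfin v)).1 hone f (edgeInduce_inc.2 ⟨hf, hfv⟩) e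
          (edgeInduce_inc.2 ⟨he, hv⟩)
      have h1 := hcard e he
      have hlt : (ends G (Y \ {e})).ncard < (ends G Y).ncard := by
        refine Set.ncard_lt_ncard ⟨ends_mono Set.sdiff_subset, fun hc ↦ ?_⟩ (finite_ends hYf)
        obtain ⟨f, hf, hfv⟩ := hc ⟨e, he, hv⟩
        exact hf.2 (huniq f hf.1 hfv)
      -- If Y = {e}, the leaf makes e a non-loop with two ends and excess -1. Otherwise deleting e
      -- also loses the end v, so the excess stays nonnegative, against minimality.
      rcases (ends G (Y \ {e})).eq_empty_or_nonempty with h | h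
      · obtain ⟨w, hw⟩ := hv
        have hnl : v ≠ w := by
          rintro rfl
          have hlf : {e | (edgeInduce G Y).IsLoopAt e v}.Finite :=
            (hfin v).subset fun e he ↦ ⟨v, he⟩
          have : e ∈ ({e | (edgeInduce G Y).IsLoopAt e v} : Set β) :=
            edgeInduce_isLink.2 ⟨he, hw⟩
          rw [(Set.ncard_eq_zero hlf).1 hloop] at this
          exact this
        have h2 : 1 < (ends G Y).ncard := (Set.one_lt_ncard (finite_ends hYf)).2
          ⟨v, ⟨e, he, hw.inc_left⟩, w, ⟨e, he, hw.inc_right⟩, hnl⟩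
        have h3 : Y.ncard = 1 := by rw [hempty e he h, Set.ncard_singleton]
        simp only [exc] at hY0
        omega
      · have h2 := hmin e he h
        simp only [exc] at h2 hY0
        omega
  obtain ⟨A, hA, hcyc⟩ := hA
  exact ⟨A, hA.1.le.trans edgeInduce_le, hcyc⟩

/-- A finite tree has fewer edges than vertices. -/
lemma IsTree.ncard_edgeSet_lt {T : Graph α β} (hT : IsTree T) (hE : T.edgeSet.Finite)
    (hV : T.vertexSet.Finite) : T.edgeSet.ncard < T.vertexSet.ncard := by
  by_contra! hcon
  have hVpos := (Set.ncard_pos hV).2 hT.1.1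
  have hne : T.edgeSet.Nonempty := (Set.ncard_pos hE).1 (by omega)
  have hsub : ends T T.edgeSet ⊆ T.vertexSet := by
    rintro v ⟨e, -, h⟩
    exact h.vertex_mem
  have h := Set.ncard_le_ncard hsub hV
  obtain ⟨C, hC, hcyc⟩ := exists_isCycle_le hE subset_rfl hne (by simp only [exc]; omega)
  exact hT.2 C hC hcyc

/-- Deleting a tree component raises the excess. -/
lemma exists_excess_lt_exc_of_isTree (hE : G.edgeSet.Finite) (hV : G.vertexSet.Finite)
    {T : Graph α β} (hT : IsComponent T G) (htree : IsTree T) :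
    ∃ Y ⊆ G.edgeSet, excess G < exc G Y := by
  have hTE := hT.1.le.edgeSet_mono
  have hTV := hT.1.le.vertexSet_mono
  refine ⟨G.edgeSet \ T.edgeSet, Set.sdiff_subset, ?_⟩
  have h1 := htree.ncard_edgeSet_lt (hE.subset hTE) (hV.subset hTV)
  have h2 : (ends G (G.edgeSet \ T.edgeSet)).ncard ≤ (G.vertexSet \ T.vertexSet).ncard := by
    refine Set.ncard_le_ncard ?_ (hV.subset Set.sdiff_subset)
    rintro v ⟨e, he, h⟩
    exact ⟨h.vertex_mem, fun hv ↦ he.2 (hT.1.closed h hv)⟩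
  have h3 := Set.ncard_sdiff_add_ncard_of_subset hTE hE
  have h4 := Set.ncard_sdiff_add_ncard_of_subset hTV hV
  simp only [exc, excess]
  omega

/-- A graph in which some set of edges has larger excess than the whole graph has a tree
component. -/
lemma exists_isTree_of_excess_lt_exc (hE : G.edgeSet.Finite) (hV : G.vertexSet.Finite)
    {Y : Set β} (hY : Y ⊆ G.edgeSet) (h : excess G < exc G Y) :
    ∃ T, IsComponent T G ∧ IsTree T := by
  classical
  -- The tree component is induced by a minimal W with |`inc W`| < |W|. The vertices missed by Y
  -- form such a set: they meet only edges outside Y, and |E \ Y| - |V \ ends Y| = Δ(G) - exc(Y) <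
  -- 0.
  let inc : Set α → Set β := fun W ↦ {e | ∃ v ∈ W, G.Inc e v}
  have hincE : ∀ W, inc W ⊆ G.edgeSet := fun W e ⟨v, _, h⟩ ↦ h.edge_mem
  have hincf : ∀ W, (inc W).Finite := fun W ↦ hE.subset (hincE W)
  have hincm : ∀ {W Z}, W ⊆ Z → inc W ⊆ inc Z := fun h e ⟨v, hv, he⟩ ↦ ⟨v, h hv, he⟩
  have hstart : (inc (G.vertexSet \ ends G Y)).ncard < (G.vertexSet \ ends G Y).ncard := by
    have hends : ends G Y ⊆ G.vertexSet := by
      rintro v ⟨e, -, h⟩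
      exact h.vertex_mem
    have h1 : (inc (G.vertexSet \ ends G Y)).ncard ≤ (G.edgeSet \ Y).ncard := by
      refine Set.ncard_le_ncard ?_ (hE.subset Set.sdiff_subset)
      rintro e ⟨v, hv, he⟩
      exact ⟨he.edge_mem, fun heY ↦ hv.2 ⟨e, heY, he⟩⟩
    have h3 := Set.ncard_sdiff_add_ncard_of_subset hY hE
    have h4 := Set.ncard_sdiff_add_ncard_of_subset hends hV
    simp only [exc, excess] at h
    omega
  obtain ⟨W, -, hWmin⟩ := (hV.finite_subsets.subset (s := {W | W ⊆ G.vertexSet})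
    (t := {W | W ⊆ G.vertexSet ∧ (inc W).ncard < W.ncard}) (fun _ h ↦ h.1)).exists_le_minimal
      (a := G.vertexSet \ ends G Y) ⟨Set.sdiff_subset, hstart⟩
  obtain ⟨hWV, hWlt⟩ := hWmin.prop
  have hWf := hV.subset hWV
  have hmin : ∀ Z ⊆ W, Z ≠ W → Z.ncard ≤ (inc Z).ncard := by
    intro Z hZ hne
    by_contra! hc
    exact hne (hZ.antisymm (hWmin.le_of_le ⟨hZ.trans hWV, hc⟩ hZ))
  -- By minimality, |W \ {v}| ≤ |`inc (W \ {v})`| ≤ |`inc W`| ≤ |W| - 1. Equality holds throughout,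
  -- so every edge at v has an end in W other than v.
  have hcl : ∀ e v w, G.IsLink e v w → v ∈ W → w ∈ W := by
    intro e v w he hv
    have h1 := hmin (W \ {v}) Set.sdiff_subset (fun h ↦ by rw [← h] at hv; exact hv.2 rfl)
    have h2 := Set.ncard_sdiff_singleton_add_one hv hWf
    have h3 : inc (W \ {v}) = inc W :=
      Set.eq_of_subset_of_ncard_le (hincm Set.sdiff_subset) (by omega) (hincf W)
    have h4 : e ∈ inc (W \ {v}) := h3 ▸ ⟨v, hv, he.inc_left⟩
    obtain ⟨u, hu, heu⟩ := h4
    rcases heu.eq_or_eq_of_isLink he with rfl | rfl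
    · exact absurd rfl hu.2
    · exact hu.1
  -- an edge set and a proper subset of `W` cannot split the edges at `W`
  have hsplit : ∀ (A : Set α) (D : Set β), A ⊆ W → A.Nonempty → D ⊆ inc W → A.ncard ≤ D.ncard →
      Disjoint D (inc (W \ A)) → False := by
    intro A D hAW hA hD hle hdisj
    have h1 := hmin (W \ A) Set.sdiff_subset (fun h ↦ by
      obtain ⟨a, ha⟩ := hA
      have ha' := hAW ha
      rw [← h] at ha'
      exact ha'.2 ha)
    have h2 := Set.ncard_sdiff_add_ncard_of_subset hAW hWf
    have h3 := Set.ncard_union_eq hdisj ((hincf W).subset hD) (hincf _)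
    have h4 := Set.ncard_le_ncard (Set.union_subset hD (hincm (Set.sdiff_subset (s := W) (t := A))))
      (hincf W)
    omega
  obtain ⟨u, hu⟩ : W.Nonempty := (Set.ncard_pos hWf).1 (by omega)
  have hclosed : (G.induce W).IsClosedSubgraph G := by
    refine Graph.IsClosedSubgraph.mk' (Graph.induce_le hWV) ?_
    rintro e v ⟨w, h⟩ hv
    exact ⟨v, w, h, hv, hcl e v w h hv⟩
  have hconn : Connected (G.induce W) := by
    set A : Set α := {w | Relation.ReflTransGen (G.induce W).Adj u w} with hA
    have hAW : A ⊆ W := by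
      intro w hw
      induction hw with
      | refl => exact hu
      | tail _ h _ =>
        obtain ⟨e, he⟩ := h
        exact he.2.2
    have hAcl : ∀ e v w, G.IsLink e v w → v ∈ A → w ∈ A := fun e v w h hv ↦
      Relation.ReflTransGen.tail hv ⟨e, h, hAW hv, hcl e v w h (hAW hv)⟩
    have hAeq : A = W := by
      -- A proper reachability class and its complement in W meet disjoint edge sets, each at least
      -- as large as its vertex set, against |`inc W`| < |W|.
      by_contra hne
      refine hsplit A (inc A) hAW ⟨u, Relation.ReflTransGen.refl⟩ (hincm hAW) (hmin A hAW hne) ?_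
      rw [Set.disjoint_left]
      rintro e ⟨v, hv, w, he⟩ ⟨v', hv', he'⟩
      rcases he'.eq_or_eq_of_isLink he with rfl | rfl
      · exact hv'.2 hv
      · exact hv'.2 (hAcl e _ _ he hv)
    refine ⟨⟨u, hu⟩, fun v hv w hw ↦ ?_⟩
    have hv : v ∈ A := hAeq ▸ hv
    have hw : w ∈ A := hAeq ▸ hw
    exact (Std.Symm.symm _ _ hv).trans hw
  refine ⟨_, ⟨hclosed, hconn⟩, hconn, fun C hC hcyc ↦ ?_⟩
  have hCW : C.vertexSet ⊆ W := hC.vertexSet_mono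
  have hCinc : C.edgeSet ⊆ inc W := by
    intro e he
    obtain ⟨a, b, hab⟩ := C.exists_isLink_of_mem_edgeSet he
    exact ⟨a, hCW hab.left_mem, b, (hC.isLink_mono hab).1⟩
  -- A cycle has as many edges as vertices, and none of its edges meets the rest of W.
  refine hsplit C.vertexSet C.edgeSet hCW hcyc.1.1 hCinc
    (hcyc.card_eq ((hincf W).subset hCinc) (hWf.subset hCW)).ge ?_
  rw [Set.disjoint_left]
  rintro e he ⟨v, hv, hev⟩
  obtain ⟨a, b, hab⟩ := C.exists_isLink_of_mem_edgeSet he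
  rcases hev.eq_or_eq_of_isLink (hC.isLink_mono hab).1 with rfl | rfl
  · exact hv.2 hab.left_mem
  · exact hv.2 hab.right_mem

/-- A finite graph has no tree component if and only if none of its sets of edges has larger excess
than the graph. -/
lemma forall_not_isTree_iff (hE : G.edgeSet.Finite) (hV : G.vertexSet.Finite) :
    (∀ T, IsComponent T G → ¬ IsTree T) ↔ ∀ Y ⊆ G.edgeSet, exc G Y ≤ excess G := by
  constructor
  · intro h Y hY
    by_contra! hc
    obtain ⟨T, hT, htree⟩ := exists_isTree_of_excess_lt_exc hE hV hY hc
    exact h T hT htree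
  · intro h T hT htree
    obtain ⟨Y, hY, hlt⟩ := exists_excess_lt_exc_of_isTree hE hV hT htree
    exact (h Y hY).not_gt hlt

/-! ### Deleting a vertex, and the rank of the matroid -/

lemma edgeSet_deleteVerts_singleton (x : α) :
    (G.deleteVerts {x}).edgeSet = G.edgeSet \ star G x := by
  ext e
  rw [Graph.edgeSet_deleteVerts]
  constructor
  · rintro ⟨u, v, h, hu, hv⟩
    refine ⟨h.edge_mem, fun hx ↦ ?_⟩
    rcases Graph.Inc.eq_or_eq_of_isLink hx h with rfl | rfl
    · exact hu rfl
    · exact hv rfl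
  · rintro ⟨he, hx⟩
    obtain ⟨u, v, h⟩ := G.exists_isLink_of_mem_edgeSet he
    refine ⟨u, v, h, ?_, ?_⟩
    · rintro rfl
      exact hx h.inc_left
    · rintro rfl
      exact hx h.inc_right

lemma exc_deleteVerts_singleton {x : α} {Y : Set β} (hY : Y ⊆ G.edgeSet \ star G x) :
    exc (G.deleteVerts {x}) Y = exc G Y := by
  have : ends (G.deleteVerts {x}) Y = ends G Y := by
    ext v
    constructor
    · rintro ⟨e, he, w, h⟩
      exact ⟨e, he, w, (G.deleteVerts_isLink _ |>.1 h).1⟩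
    · rintro ⟨e, he, w, h⟩
      refine ⟨e, he, w, (G.deleteVerts_isLink _).2 ⟨h, ?_, ?_⟩⟩
      · rintro rfl
        exact (hY he).2 h.inc_left
      · rintro rfl
        exact (hY he).2 h.inc_right
  rw [exc, exc, this]

lemma kCircularMatroid_indep_iff_exc_lt {hE : G.edgeSet.Finite} {k : ℕ} {hk : 1 ≤ k} {I : Set β} :
    (kCircularMatroid G hE k hk).Indep I ↔ I ⊆ G.edgeSet ∧ ∀ Y ⊆ I, exc G Y < k := by
  rw [kCircularMatroid_indep_iff]
  exact and_congr_right fun h ↦ noCircuit_iff hk h (hE.subset h)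

/-- This is the attained half of the rank formula. The case `I = X` is excluded because all subsets
of an independent set may have excess below k - 1. -/
lemma exists_exc_eq_of_isBasis {hE : G.edgeSet.Finite} {k : ℕ} {hk : 1 ≤ k} {I X : Set β}
    (hI : (kCircularMatroid G hE k hk).IsBasis I X) (hne : I ≠ X) :
    ∃ Y ⊆ X, exc G Y = k - 1 + X.ncard - I.ncard := by
  have hXE : X ⊆ G.edgeSet := hI.subset_ground
  refine exists_exc_eq_of_maximal (hE.subset hXE) hI.subset hne
    (kCircularMatroid_indep_iff_exc_lt.1 hI.indep).2 fun e he heI ↦ ?_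
  by_contra! hcon
  refine heI (hI.mem_of_insert_indep he (kCircularMatroid_indep_iff_exc_lt.2 ⟨?_, hcon⟩))
  exact Set.insert_subset (hXE he) (hI.subset.trans hXE)

/-- If the circuits cover the edges, the rank of the `k`-circular matroid is `|V(G)| + k - 1`. -/
lemma ncard_of_isBase {hE : G.edgeSet.Finite} {k : ℕ} {hk : 1 ≤ k}
    (hiso : ∀ v ∈ G.vertexSet, ∃ e, G.Inc e v) (hne : G.edgeSet.Nonempty)
    (hcov : ∀ e ∈ G.edgeSet, ∃ C ∈ circuits G k, e ∈ C) {B : Set β}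
    (hB : (kCircularMatroid G hE k hk).IsBase B) :
    (B.ncard : ℤ) = G.vertexSet.ncard + k - 1 := by
  have hBE : B ⊆ G.edgeSet := hB.subset_ground
  have hBi := (kCircularMatroid_indep_iff_exc_lt.1 hB.indep).2
  have hBne : B ≠ G.edgeSet := by
    rintro rfl
    obtain ⟨e, he⟩ := hne
    obtain ⟨C, hC, -⟩ := hcov e he
    exact (kCircularMatroid_indep_iff.1 hB.indep).2 C hC hC.1
  obtain ⟨Y, hY, hYeq⟩ := exists_exc_eq_of_isBasis hB.isBasis_ground hBne
  rw [kCircularMatroid_ground] at hY hYeq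
  have h1 := exc_le_exc_edgeSet hE hcov hY
  have h2 := exc_le_of_forall_exc_lt hE hBE hBi subset_rfl
  have h3 : exc G G.edgeSet = G.edgeSet.ncard - G.vertexSet.ncard := by
    rw [exc, ends_edgeSet hiso]
  omega

end

end KCircular

/-! ### The cocircuit criterion -/

theorem mainTheorem6 {α β : Type*} (G : Graph α β)
    (hV : G.vertexSet.Finite) (hE : G.edgeSet.Finite)
    (hiso : ∀ v ∈ G.vertexSet, ∃ e, G.Inc e v)
    (k : ℕ) (hk : 1 ≤ k)
    (hconn : KCircular.MatroidConnected (KCircular.kCircularMatroid G hE k hk))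
    (x : α) (hx : x ∈ G.vertexSet)
    (hs : (KCircular.star G x).encard ≤ (KCircular.kCircularMatroid G hE k hk)✶.eRank + 1) :
    (KCircular.kCircularMatroid G hE k hk).IsCocircuit (KCircular.star G x) ↔
      ∀ T, KCircular.IsComponent T (G.deleteVerts {x}) → ¬ KCircular.IsTree T := by
  open KCircular in
  classical
  set M := kCircularMatroid G hE k hk with hM
  set F := G.edgeSet \ star G x with hF
  have hFE : F ⊆ G.edgeSet := Set.sdiff_subset
  have hFf := hE.subset hFE
  have hSE : star G x ⊆ G.edgeSet := fun e he ↦ Graph.Inc.edge_mem he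
  have hSF : F.ncard + (star G x).ncard = G.edgeSet.ncard :=
    Set.ncard_sdiff_add_ncard_of_subset hSE hE
  have hcov : ∀ e ∈ G.edgeSet, ∃ C ∈ circuits G k, e ∈ C := fun e he ↦ by
    obtain ⟨C, hC, heC, -⟩ := hconn.2.2 e he e he
    exact ⟨C, kCircularMatroid_isCircuit_iff.1 hC, heC⟩
  obtain ⟨e₀, he₀⟩ := hiso x hx
  have hbase : ∀ B, M.IsBase B → (B.ncard : ℤ) = G.vertexSet.ncard + k - 1 := fun B hB ↦
    ncard_of_isBase hiso ⟨e₀, he₀.edge_mem⟩ hcov hB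
  obtain ⟨B₀, hB₀⟩ := M.exists_isBase
  have hB₀E : B₀ ⊆ G.edgeSet := hB₀.subset_ground
  -- This is the not-k-big hypothesis: the corank is |E| - |V| - k + 1, so at least |V| + k - 2
  -- edges avoid x.
  have hFcard : (G.vertexSet.ncard : ℤ) + k - 2 ≤ F.ncard := by
    have h1 : M✶.eRank = (G.edgeSet \ B₀).encard := hB₀.compl_isBase_dual.encard_eq_eRank.symm
    rw [h1, ← (hE.subset hSE).cast_ncard_eq, ← (hE.subset Set.sdiff_subset).cast_ncard_eq] at hs
    have h2 : (star G x).ncard ≤ (G.edgeSet \ B₀).ncard + 1 := by exact_mod_cast hs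
    have h3 := Set.ncard_sdiff_add_ncard_of_subset hB₀E hE
    have h4 := hbase B₀ hB₀
    omega
  have hVx : (G.vertexSet \ {x}).ncard + 1 = G.vertexSet.ncard :=
    Set.ncard_sdiff_singleton_add_one hx hV
  have hHE : (G.deleteVerts {x}).edgeSet = F := edgeSet_deleteVerts_singleton x
  have hHV : (G.deleteVerts {x}).vertexSet = G.vertexSet \ {x} := G.vertexSet_deleteVerts {x}
  rw [forall_not_isTree_iff (hHE ▸ hFf) (hHV ▸ hV.subset Set.sdiff_subset), excess, hHE, hHV]
  have hendsF : ∀ Y ⊆ F, x ∉ ends G Y := fun Y hY ⟨e, he, hex⟩ ↦ (hY he).2 hex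
  rw [Matroid.isCocircuit_iff_minimal]
  constructor
  · intro hmin Y hY
    rw [exc_deleteVerts_singleton hY]
    -- By minimality some base B meets the star at most in `e₀`. Then `B \ {e₀}` is independent in F
    -- with at least |V| + k - 2 elements, which bounds every excess in F.
    obtain ⟨B, hB, hBS⟩ : ∃ B, M.IsBase B ∧ ¬ ((star G x \ {e₀}) ∩ B).Nonempty := by
      by_contra! hcon
      exact (hmin.le_of_le hcon Set.sdiff_subset he₀).2 rfl
    have hBE : B ⊆ G.edgeSet := hB.subset_ground
    have hsub : B \ {e₀} ⊆ F := fun f hf ↦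
      ⟨hBE hf.1, fun hfS ↦ hBS ⟨f, ⟨hfS, hf.2⟩, hf.1⟩⟩
    have hBi := (kCircularMatroid_indep_iff_exc_lt.1 hB.indep).2
    have h1 := exc_le_of_forall_exc_lt hFf hsub
      (fun Z hZ ↦ hBi Z (hZ.trans Set.sdiff_subset)) hY
    have h2 := Set.pred_ncard_le_ncard_sdiff_singleton B e₀
    have h3 := hbase B hB
    omega
  · intro h
    have hendsle : (ends G F).ncard ≤ (G.vertexSet \ {x}).ncard := by
      refine Set.ncard_le_ncard (fun v hv ↦ ⟨?_, ?_⟩) (hV.subset Set.sdiff_subset)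
      · obtain ⟨e, -, he⟩ := hv
        exact he.vertex_mem
      · rintro rfl
        exact hendsF F subset_rfl hv
    obtain ⟨I, hI⟩ := M.exists_isBasis F hFE
    have hIi := (kCircularMatroid_indep_iff_exc_lt.1 hI.indep).2
    -- Either F is independent and the not-k-big bound applies, or the rank of F is read off from a
    -- subset of maximum excess, bounded by the absence of tree components.
    have hIcard : (G.vertexSet.ncard : ℤ) + k - 2 ≤ I.ncard := by
      by_cases hIF : I = F
      · rw [hIF]
        exact hFcard
      · obtain ⟨Y, hY, hYeq⟩ := exists_exc_eq_of_isBasis hI hIF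
        have := h Y hY
        rw [exc_deleteVerts_singleton hY] at this
        omega
    refine ⟨fun B hB ↦ ?_, fun K hK hKS e he ↦ ?_⟩
    · by_contra hcon
      have hBF : B ⊆ F := fun f hf ↦ ⟨hB.subset_ground hf, fun hfS ↦ hcon ⟨f, hfS, hf⟩⟩
      have h1 := exc_le_of_forall_exc_lt hFf hBF
        (kCircularMatroid_indep_iff_exc_lt.1 hB.indep).2 subset_rfl
      have h2 := hbase B hB
      simp only [exc] at h1
      omega
    · have heI : e ∉ I := fun h ↦ (hI.subset h).2 he
      -- Since e is the only edge of `insert e I` at x, adding it to a subset of I creates the new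
      -- end x and cannot raise the excess. Hence `insert e I` is a base meeting the star only in e.
      have hind : M.Indep (insert e I) := by
        refine kCircularMatroid_indep_iff_exc_lt.2
          ⟨Set.insert_subset (hSE he) (hI.subset.trans hFE), fun Y hY ↦ ?_⟩
        by_cases heY : e ∈ Y
        · have hYf : Y.Finite := ((hFf.subset hI.subset).insert e).subset hY
          have hsub : Y \ {e} ⊆ I := fun f hf ↦ (hY hf.1).resolve_left hf.2
          have h1 := hIi _ hsub
          have h2 := Set.ncard_sdiff_singleton_add_one heY hYf
          have h3 : (ends G (Y \ {e})).ncard < (ends G Y).ncard :=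
            Set.ncard_lt_ncard ⟨ends_mono Set.sdiff_subset, fun hc ↦
              hendsF _ (hsub.trans hI.subset) (hc ⟨e, heY, he⟩)⟩ (finite_ends hYf)
          simp only [exc] at h1 ⊢
          omega
        · exact hIi Y ((Set.subset_insert_iff_of_notMem heY).1 hY)
      obtain ⟨B, hB, hIB⟩ := hind.exists_isBase_superset
      have hBeq : insert e I = B := by
        refine Set.eq_of_subset_of_ncard_le hIB ?_ (hE.subset hB.subset_ground)
        rw [Set.ncard_insert_of_notMem heI (hFf.subset hI.subset)]
        have := hbase B hB
        omega
      obtain ⟨f, hfK, hfB⟩ := hK B hB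
      rw [← hBeq] at hfB
      rcases hfB with rfl | hfI
      · exact hfK
      · exact absurd (hKS hfK) (hI.subset hfI).2
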